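/- Let $\Gamma$ be a countable group. A measure preserving action $\mathbf a=\Gamma\curvearrowright^a(X,\mu)$ is a Borel action of $\Gamma$ on a standard Borel space $X$ equipped with a Borel probability measure $\mu$ that the action preserves. We write $\mathbf a\prec\mathbf b$, for $\mathbf b=\Gamma\curvearrowright^b(Y,\nu)$, if for every finite Borel partition $A_0,\dots,A_{k-1}$ of $X$, every finite $F\subseteq\Gamma$ and every $\epsilon>0$ there is a Borel partition $B_0,\dots,B_{k-1}$ of $Y$ with $|\mu(\gamma^aA_i\cap A_j)-\nu(\gamma^bB_i\cap B_j)|<\epsilon$ for all $\gamma\in F$ and $i,j<k$; and $\mathbf a\sim\mathbf b$ (weak equivalence) if $\mathbf a\prec\mathbf b$ and $\mathbf b\prec\mathbf a$. Let $\mathrm{Sub}(\Gamma)\subseteq 2^\Gamma$ be the space of subgroups of $\Gamma$, with the topology induced by the product topology, and let $\mathrm{IRS}(\Gamma)$ be the space of conjugation-invariant Borel probability measures on $\mathrm{Sub}(\Gamma)$, with the weak$^*$ topology. The type of $\mathbf a$ is $\mathrm{type}(\mathbf a)=(\mathrm{stab}_a)_*\mu\in\mathrm{IRS}(\Gamma)$,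 where $\mathrm{stab}_a(x)=\{\gamma\in\Gamma:\gamma^ax=x\}$. Let $K$ be a space homeomorphic to the Cantor space $2^{\mathbb N}$, let $M_s(K^\Gamma)$ be the compact space of Borel probability measures on $K^\Gamma$ invariant under the shift $(\gamma\cdot f)(\delta)=f(\gamma^{-1}\delta)$, with the weak$^*$ topology, and let $E(\mathbf a,K)\subseteq M_s(K^\Gamma)$ be the set of all measures $(\Phi^{\phi,a})_*\mu$ with $\phi:X\to K$ Borel, where $\Phi^{\phi,a}(x)(\gamma)=\phi((\gamma^{-1})^ax)$. For a fixed standard probability space $(X,\mu)$ let $A_\sim(\Gamma,X,\mu)$ be the set of weak equivalence classes $[\mathbf a]$ of measure preserving actions of $\Gamma$ on $(X,\mu)$, with the topology $\tau$ obtained by identifying $[\mathbf a]$ with the nonempty compact set $\overline{E(\mathbf a,K)}$ and using the Vietoris topology on the nonempty compact subsets of $M_s(K^\Gamma)$ (the Abért–Elek topology). Then: 1. If $\mathbf a$ and $\mathbf b$ are weakly equivalent measure preserving actions of $\Gamma$ (on possibly different standard probability spaces), then $\mathrm{type}(\mathbf a)=\mathrm{type}(\mathbf b)$. 2. For every standard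 probability space $(X,\mu)$ the map $[\mathbf a]\mapsto\mathrm{type}(\mathbf a)$ from $(A_\sim(\Gamma,X,\mu),\tau)$ to $\mathrm{IRS}(\Gamma)$ is (well defined and) continuous. -/

import Mathlib

open MeasureTheory Topology TopologicalSpace

noncomputable section

namespace WeakEq

/-! ### Measure preserving actions and weak containment -/

/-- A measure preserving action of the group `Γ` on `(X, μ)`: an action of `Γ` on `X` by
measurable bijections that preserve `μ`. For countable `Γ` and standard Borel `X` this is a Borel
action `Γ × X → X` preserving `μ`. -/
structure MPAction (Γ : Type*) [Group Γ] {X : Type*} [MeasurableSpace X] (μ : Measure X) where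
  act : Γ →* Equiv.Perm X
  measurePreserving : ∀ γ : Γ, MeasurePreserving (act γ) μ μ

/-- A finite Borel partition `A 0, …, A (k - 1)` of `X` (pieces may be empty). -/
structure IsBorelPartition {X : Type*} [MeasurableSpace X] {k : ℕ} (A : Fin k → Set X) : Prop where
  measurableSet : ∀ i, MeasurableSet (A i)
  disjoint : ∀ i j, i ≠ j → Disjoint (A i) (A j)
  iUnion_eq : ⋃ i, A i = Set.univ

/-- Weak containment `a ≺ b` of measure preserving actions. -/
def WeaklyContained {Γ : Type*} [Group Γ] {X : Type*} [MeasurableSpace X] {μ : Measure X}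
    {Y : Type*} [MeasurableSpace Y] {ν : Measure Y} (a : MPAction Γ μ) (b : MPAction Γ ν) : Prop :=
  ∀ (k : ℕ) (A : Fin k → Set X), IsBorelPartition A → ∀ (F : Finset Γ) (ε : ℝ), 0 < ε →
    ∃ B : Fin k → Set Y, IsBorelPartition B ∧
      ∀ γ ∈ F, ∀ i j : Fin k,
        |μ.real ((a.act γ '' A i) ∩ A j) - ν.real ((b.act γ '' B i) ∩ B j)| < ε

/-- Weak equivalence `a ∼ b` of measure preserving actions. -/
def WeaklyEquivalent {Γ : Type*} [Group Γ] {X : Type*} [MeasurableSpace X] {μ : Measure X}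
    {Y : Type*} [MeasurableSpace Y] {ν : Measure Y} (a : MPAction Γ μ) (b : MPAction Γ ν) : Prop :=
  WeaklyContained a b ∧ WeaklyContained b a

theorem WeaklyContained.refl {Γ : Type*} [Group Γ] {X : Type*} [MeasurableSpace X] {μ : Measure X}
    (a : MPAction Γ μ) : WeaklyContained a a := by
  intro k A hA F ε hε
  exact ⟨A, hA, fun γ _ i j => by simpa using hε⟩

theorem WeaklyContained.trans {Γ : Type*} [Group Γ] {X : Type*} [MeasurableSpace X]
    {μ : Measure X} {Y : Type*} [MeasurableSpace Y] {ν : Measure Y}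
    {Z : Type*} [MeasurableSpace Z] {η : Measure Z}
    {a : MPAction Γ μ} {b : MPAction Γ ν} {c : MPAction Γ η}
    (hab : WeaklyContained a b) (hbc : WeaklyContained b c) : WeaklyContained a c := by
  intro k A hA F ε hε
  obtain ⟨B, hB, h1⟩ := hab k A hA F (ε / 2) (half_pos hε)
  obtain ⟨C, hC, h2⟩ := hbc k B hB F (ε / 2) (half_pos hε)
  refine ⟨C, hC, fun γ hγ i j => ?_⟩
  have h3 := h1 γ hγ i j
  have h4 := h2 γ hγ i j
  rw [abs_lt] at *
  constructor <;> linarith [h3.1, h3.2, h4.1, h4.2]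

/-- Actions on `(X, μ)` that agree almost everywhere are weakly equivalent, so that weak
equivalence classes of actions are the same thing as weak equivalence classes of actions modulo
almost everywhere equality. -/
theorem weaklyEquivalent_of_ae_eq {Γ : Type*} [Group Γ] {X : Type*} [MeasurableSpace X]
    {μ : Measure X} {a b : MPAction Γ μ} (h : ∀ γ : Γ, ∀ᵐ x ∂μ, a.act γ x = b.act γ x) :
    WeaklyEquivalent a b := by
  have key : ∀ a b : MPAction Γ μ, (∀ γ : Γ, ∀ᵐ x ∂μ, a.act γ x = b.act γ x) →
      WeaklyContained a b := by
    intro a b h k A hA F ε hε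
    refine ⟨A, hA, fun γ _ i j => ?_⟩
    have e : ((a.act γ '' A i) ∩ A j : Set X) =ᵐ[μ] ((b.act γ '' A i) ∩ A j : Set X) := by
      filter_upwards [h γ⁻¹] with x hx
      have h1 : x ∈ a.act γ '' A i ↔ x ∈ b.act γ '' A i := by
        rw [Equiv.image_eq_preimage_symm, Equiv.image_eq_preimage_symm]
        simp only [map_inv] at hx
        change (a.act γ)⁻¹ x ∈ A i ↔ (b.act γ)⁻¹ x ∈ A i
        rw [hx]
      have h2 : x ∈ (a.act γ '' A i) ∩ A j ↔ x ∈ (b.act γ '' A i) ∩ A j :=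
        and_congr_left fun _ => h1
      exact propext h2
    rw [measureReal_congr e]
    simpa using hε
  exact ⟨key a b h, key b a fun γ => (h γ).mono fun _ hx => hx.symm⟩

/-- Weak equivalence as an equivalence relation on the actions of `Γ` on `(X, μ)`. -/
def weakSetoid (Γ : Type*) [Group Γ] {X : Type*} [MeasurableSpace X] (μ : Measure X) :
    Setoid (MPAction Γ μ) where
  r a b := WeaklyEquivalent a b
  iseqv :=
    { refl := fun a => ⟨.refl a, .refl a⟩
      symm := fun h => ⟨h.2, h.1⟩
      trans := fun h h' => ⟨h.1.trans h'.1, h'.2.trans h.2⟩ }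

/-- The set `A_∼(Γ, X, μ)` of weak equivalence classes of actions of `Γ` on `(X, μ)`. -/
def WeakClass (Γ : Type*) [Group Γ] {X : Type*} [MeasurableSpace X] (μ : Measure X) : Type _ :=
  Quotient (weakSetoid Γ μ)

/-- The weak equivalence class `[a]`. -/
def MPAction.weakClass {Γ : Type*} [Group Γ] {X : Type*} [MeasurableSpace X] {μ : Measure X}
    (a : MPAction Γ μ) : WeakClass Γ μ :=
  Quotient.mk (weakSetoid Γ μ) a

/-! ### Invariant random subgroups and types -/

/-- The indicator embedding of `Sub(Γ)`, the set of subgroups of `Γ`, into `2^Γ`. -/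
def subIndicator {Γ : Type*} [Group Γ] (H : Subgroup Γ) : Γ → Bool :=
  fun γ => @decide (γ ∈ H) (Classical.propDecidable _)

/-- `Sub(Γ)` carries the subspace topology of the product space `2^Γ`. -/
instance subTopology (Γ : Type*) [Group Γ] : TopologicalSpace (Subgroup Γ) :=
  TopologicalSpace.induced subIndicator inferInstance

instance subMeasurableSpace (Γ : Type*) [Group Γ] : MeasurableSpace (Subgroup Γ) :=
  borel (Subgroup Γ)

instance subBorelSpace (Γ : Type*) [Group Γ] : BorelSpace (Subgroup Γ) := ⟨rfl⟩

/-- The conjugation action of `Γ` on `Sub(Γ)`, `γ · H = γ H γ⁻¹`. -/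
def conjSub {Γ : Type*} [Group Γ] (γ : Γ) (H : Subgroup Γ) : Subgroup Γ :=
  H.map (MulAut.conj γ).toMonoidHom

/-- The space `IRS(Γ)` of conjugation-invariant Borel probability measures on `Sub(Γ)`, with the
weak-* topology (as a subspace of Mathlib's space of probability measures). -/
abbrev IRS (Γ : Type*) [Group Γ] : Type _ :=
  {θ : ProbabilityMeasure (Subgroup Γ) //
    ∀ γ : Γ, MeasurePreserving (conjSub γ) (θ : Measure (Subgroup Γ)) θ}

/-- The stabilizer of the point `x`. -/
def MPAction.stab {Γ : Type*} [Group Γ] {X : Type*} [MeasurableSpace X] {μ : Measure X}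
    (a : MPAction Γ μ) (x : X) : Subgroup Γ where
  carrier := {γ | a.act γ x = x}
  one_mem' := by simp
  mul_mem' := by
    intro γ δ hγ hδ
    simp only [Set.mem_ofPred_eq] at *
    rw [map_mul, Equiv.Perm.mul_apply, hδ, hγ]
  inv_mem' := by
    intro γ hγ
    simp only [Set.mem_ofPred_eq] at *
    rw [map_inv, Equiv.Perm.inv_eq_iff_eq, hγ]

theorem subMeasurableSpace_eq_comap (Γ : Type*) [Group Γ] [Countable Γ] :
    subMeasurableSpace Γ = MeasurableSpace.comap subIndicator inferInstance := by
  change borel (Subgroup Γ) = _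
  rw [BorelSpace.measurable_eq (α := Γ → Bool)]
  exact borel_comap

theorem measurable_sub_iff {Γ : Type*} [Group Γ] [Countable Γ] {X : Type*} [MeasurableSpace X]
    (f : X → Subgroup Γ) : Measurable f ↔ ∀ γ : Γ, MeasurableSet {x | γ ∈ f x} := by
  rw [subMeasurableSpace_eq_comap, measurable_comap_iff, measurable_pi_iff]
  refine forall_congr' fun γ => ?_
  have h : (fun x => (subIndicator ∘ f) x γ) ⁻¹' {true} = {x | γ ∈ f x} := by
    ext x
    simp [subIndicator]
  rw [← h]
  refine ⟨fun hf => hf (MeasurableSet.singleton _), fun hf => measurable_to_bool hf⟩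

theorem MPAction.measurable_stab {Γ : Type*} [Group Γ] [Countable Γ] {X : Type*}
    [MeasurableSpace X] [StandardBorelSpace X] {μ : Measure X} (a : MPAction Γ μ) :
    Measurable a.stab := by
  rw [measurable_sub_iff]
  intro γ
  exact measurableSet_eq_fun (a.measurePreserving γ).measurable measurable_id

theorem measurable_conjSub {Γ : Type*} [Group Γ] [Countable Γ] (γ : Γ) :
    Measurable (conjSub γ) := by
  rw [measurable_sub_iff]
  intro δ
  have h := (measurable_sub_iff (id : Subgroup Γ → Subgroup Γ)).1 measurable_id (γ⁻¹ * δ * γ)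
  convert h using 1
  ext H
  simp only [conjSub, Set.mem_ofPred_eq, id, Subgroup.mem_map]
  constructor
  · rintro ⟨y, hy, rfl⟩
    simpa [mul_assoc] using hy
  · intro hy
    exact ⟨_, hy, by simp [mul_assoc]⟩

theorem MPAction.stab_act {Γ : Type*} [Group Γ] {X : Type*} [MeasurableSpace X] {μ : Measure X}
    (a : MPAction Γ μ) (γ : Γ) (x : X) : a.stab (a.act γ x) = conjSub γ (a.stab x) := by
  ext δ
  simp only [conjSub, Subgroup.mem_map]
  change a.act δ (a.act γ x) = a.act γ x ↔ _
  constructor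
  · intro h
    refine ⟨γ⁻¹ * δ * γ, ?_, by simp [mul_assoc]⟩
    change a.act (γ⁻¹ * δ * γ) x = x
    rw [map_mul, map_mul, Equiv.Perm.mul_apply, Equiv.Perm.mul_apply, h, map_inv]
    simp
  · rintro ⟨y, hy, rfl⟩
    change a.act y x = x at hy
    simp [hy]

/-- The type of a measure preserving action on a standard probability space: the push-forward of
`μ` under the stabilizer map. -/
def MPAction.type {Γ : Type*} [Group Γ] [Countable Γ] {X : Type*}
    [MeasurableSpace X] [StandardBorelSpace X] {μ : Measure X} [IsProbabilityMeasure μ]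
    (a : MPAction Γ μ) : IRS Γ :=
  ⟨⟨μ.map a.stab, Measure.isProbabilityMeasure_map a.measurable_stab.aemeasurable⟩, by
    intro γ
    refine ⟨measurable_conjSub γ, ?_⟩
    change (μ.map a.stab).map (conjSub γ) = μ.map a.stab
    rw [Measure.map_map (measurable_conjSub γ) a.measurable_stab]
    have h : conjSub γ ∘ a.stab = a.stab ∘ a.act γ := funext fun x => (a.stab_act γ x).symm
    rw [h, ← Measure.map_map a.measurable_stab (a.measurePreserving γ).measurable,
      (a.measurePreserving γ).map_eq]⟩

/-! ### Shift-invariant measures and the topology on weak equivalence classes -/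

/-- The shift action of `Γ` on `K^Γ`, `(γ · f) δ = f (γ⁻¹ δ)`. -/
def shift {Γ : Type*} [Group Γ] {K : Type*} (γ : Γ) (f : Γ → K) : Γ → K :=
  fun δ => f (γ⁻¹ * δ)

theorem measurable_shift {Γ : Type*} [Group Γ] {K : Type*} [MeasurableSpace K] (γ : Γ) :
    Measurable (shift γ : (Γ → K) → (Γ → K)) :=
  measurable_pi_iff.2 fun δ => measurable_pi_apply (γ⁻¹ * δ)

theorem continuous_shift {Γ : Type*} [Group Γ] {K : Type*} [TopologicalSpace K] (γ : Γ) :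
    Continuous (shift γ : (Γ → K) → (Γ → K)) :=
  continuous_pi fun δ => continuous_apply (γ⁻¹ * δ)

/-- The space `M_s(K^Γ)` of shift-invariant Borel probability measures on `K^Γ`, with the weak-*
topology. -/
abbrev ShiftInvMeasure (Γ : Type*) [Group Γ] (K : Type*) [MeasurableSpace K] : Type _ :=
  {lam : ProbabilityMeasure (Γ → K) //
    ∀ γ : Γ, MeasurePreserving (shift γ) (lam : Measure (Γ → K)) lam}

/-- The map `Φ^{φ,a} : X → K^Γ`, `Φ^{φ,a} x γ = φ (γ⁻¹ · x)`. -/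
def MPAction.orbitMap {Γ : Type*} [Group Γ] {X : Type*} [MeasurableSpace X] {μ : Measure X}
    (a : MPAction Γ μ) {K : Type*} (φ : X → K) (x : X) : Γ → K :=
  fun γ => φ (a.act γ⁻¹ x)

theorem MPAction.measurable_orbitMap {Γ : Type*} [Group Γ] {X : Type*} [MeasurableSpace X]
    {μ : Measure X} (a : MPAction Γ μ) {K : Type*} [MeasurableSpace K] {φ : X → K}
    (hφ : Measurable φ) : Measurable (a.orbitMap φ) :=
  measurable_pi_iff.2 fun γ => hφ.comp (a.measurePreserving γ⁻¹).measurable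

theorem MPAction.orbitMap_act {Γ : Type*} [Group Γ] {X : Type*} [MeasurableSpace X]
    {μ : Measure X} (a : MPAction Γ μ) {K : Type*} (φ : X → K) (γ : Γ) (x : X) :
    a.orbitMap φ (a.act γ x) = shift γ (a.orbitMap φ x) := by
  funext δ
  simp [orbitMap, shift]

/-- The shift-invariant measure `(Φ^{φ,a})_* μ`. -/
def MPAction.factorMeasure {Γ : Type*} [Group Γ] {X : Type*} [MeasurableSpace X]
    {μ : Measure X} [IsProbabilityMeasure μ] (a : MPAction Γ μ) {K : Type*} [MeasurableSpace K]
    (φ : X → K) (hφ : Measurable φ) : ShiftInvMeasure Γ K :=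
  ⟨⟨μ.map (a.orbitMap φ),
      Measure.isProbabilityMeasure_map (a.measurable_orbitMap hφ).aemeasurable⟩, by
    intro γ
    refine ⟨measurable_shift γ, ?_⟩
    change (μ.map (a.orbitMap φ)).map (shift γ) = μ.map (a.orbitMap φ)
    rw [Measure.map_map (measurable_shift γ) (a.measurable_orbitMap hφ)]
    have h : shift γ ∘ a.orbitMap φ = a.orbitMap φ ∘ a.act γ :=
      funext fun x => (a.orbitMap_act φ γ x).symm
    rw [h, ← Measure.map_map (a.measurable_orbitMap hφ) (a.measurePreserving γ).measurable,
      (a.measurePreserving γ).map_eq]⟩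

/-- The set `E(a, K) = {(Φ^{φ,a})_* μ | φ : X → K Borel} ⊆ M_s(K^Γ)`. -/
def MPAction.factorSet {Γ : Type*} [Group Γ] {X : Type*} [MeasurableSpace X]
    {μ : Measure X} [IsProbabilityMeasure μ] (a : MPAction Γ μ) (K : Type*) [MeasurableSpace K] :
    Set (ShiftInvMeasure Γ K) :=
  {lam | ∃ (φ : X → K) (hφ : Measurable φ), lam = a.factorMeasure φ hφ}

theorem MPAction.factorSet_nonempty {Γ : Type*} [Group Γ] {X : Type*} [MeasurableSpace X]
    {μ : Measure X} [IsProbabilityMeasure μ] (a : MPAction Γ μ) (K : Type*) [MeasurableSpace K]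
    [Nonempty K] : (a.factorSet K).Nonempty :=
  ⟨_, fun _ => Classical.arbitrary K, measurable_const, rfl⟩

/-- For a compact Polish space `K` the space `M_s(K^Γ)` is compact. -/
instance compactSpace_shiftInvMeasure (Γ : Type*) [Group Γ] [Countable Γ] (K : Type*)
    [TopologicalSpace K] [CompactSpace K] [PolishSpace K] [MeasurableSpace K] [BorelSpace K] :
    CompactSpace (ShiftInvMeasure Γ K) := by
  refine IsClosedEmbedding.compactSpace (f := Subtype.val) ⟨.subtypeVal, ?_⟩
  rw [Subtype.range_coe_subtype]
  have h : {lam : ProbabilityMeasure (Γ → K) |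
      ∀ γ : Γ, MeasurePreserving (shift γ) (lam : Measure (Γ → K)) lam} =
      ⋂ γ : Γ, {lam | lam.map (continuous_shift γ).measurable.aemeasurable = lam} := by
    ext lam
    simp only [Set.mem_ofPred_eq, Set.mem_iInter]
    refine forall_congr' fun γ => ⟨fun h => Subtype.ext h.map_eq, fun h => ?_⟩
    exact ⟨measurable_shift γ, congrArg Subtype.val h⟩
  rw [h]
  exact isClosed_iInter fun γ =>
    isClosed_eq (ProbabilityMeasure.continuous_map (continuous_shift γ)) continuous_id

/-- The map `a ↦ closure E(a, K)` from actions on `(X, μ)` to nonempty compact subsets of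
`M_s(K^Γ)`. -/
def MPAction.closedFactorSet {Γ : Type*} [Group Γ] [Countable Γ] {X : Type*} [MeasurableSpace X]
    {μ : Measure X} [IsProbabilityMeasure μ] (K : Type*)
    [TopologicalSpace K] [CompactSpace K] [PolishSpace K] [Nonempty K]
    [MeasurableSpace K] [BorelSpace K] (a : MPAction Γ μ) :
    NonemptyCompacts (ShiftInvMeasure Γ K) where
  carrier := closure (a.factorSet K)
  isCompact' := isClosed_closure.isCompact
  nonempty' := (a.factorSet_nonempty K).closure

/-- The Abért–Elek topology `τ` on weak equivalence classes, transported from the Vietoris topology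
on the nonempty compact subsets of `M_s(K^Γ)` (Mathlib's topology on `NonemptyCompacts`) by
`[a] ↦ closure E(a, K)`, with `K` a Cantor space: a set `U` of classes is open iff there is a
Vietoris-open `V` such that, for all actions `a` on `(X, μ)`, `[a] ∈ U ↔ closure E(a, K) ∈ V`.
(Since `closure E(a, K)` determines and is determined by `[a]`, this is the topology that makes
`[a] ↦ closure E(a, K)` a homeomorphism onto its image.) -/
abbrev weakClassTopology {Γ : Type*} [Group Γ] [Countable Γ] {X : Type*} [MeasurableSpace X]
    (μ : Measure X) [IsProbabilityMeasure μ] (K : Type*)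
    [TopologicalSpace K] [CompactSpace K] [PolishSpace K] [Nonempty K]
    [MeasurableSpace K] [BorelSpace K] : TopologicalSpace (WeakClass Γ μ) :=
  TopologicalSpace.coinduced MPAction.weakClass
    (TopologicalSpace.induced (MPAction.closedFactorSet (Γ := Γ) (μ := μ) K)
      NonemptyCompacts.topology)

end WeakEq

end

/-! The type of `a` is determined by the numbers μ(D_F), F ⊆ Γ finite, where D_F is the set of
points fixed by no element of F: the events "H misses F" form a generating π-system of clopen sets
in Sub(Γ), and a compactness argument shows that convergence on them is exactly weak* convergence.
So everything reduces to D_F.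

The combinatorial input is that an automorphism has a measurable 3-colouring in which every
non-fixed point differs from its image. Combining these colourings over F cuts D_F into finitely
many pieces A with γA ∩ A = ∅ for all γ ∈ F. Weak containment copies such a partition with small
error, and a point of the copy fixed by some γ ∈ F either lies in the copy of the complement of D_F
or in one of the small sets γB ∩ B. Hence μ(D_F) can only grow under `≺`, which gives part 1.

For part 2, the same colouring, coded into K, shows that μ(D_F) is the maximum over the closure of
E(a, K) of one continuous function, the measure of a fixed clopen subset of K^Γ. Such a maximum is
continuous for the Vietoris topology. -/

namespace WeakEq

/-! ### Finite colourings separating points from their images -/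

/-- A countable cover of the non-fixed points of `T` by sets disjoint from their images yields a
set disjoint from its image whose translates under `T` and `T⁻¹` cover the non-fixed points. -/
theorem exists_maximal_independent {X : Type*} [MeasurableSpace X] (T : X ≃ᵐ X) (A : ℕ → Set X)
    (hA : ∀ n, MeasurableSet (A n)) (hAT : ∀ n, ∀ x ∈ A n, T x ∉ A n) :
    ∃ B : Set X, MeasurableSet B ∧ (∀ x ∈ B, T x ∉ B) ∧
      ∀ n, ∀ x ∈ A n, x ∈ B ∨ T x ∈ B ∨ T.symm x ∈ B := by
  -- Greedy choice: stage n adds the points of `A n` whose image and preimage have not been chosen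
  -- yet.
  let S : ℕ → Set X := fun n =>
    Nat.rec ∅ (fun n s => s ∪ (A n ∩ (T ⁻¹' s)ᶜ ∩ (T.symm ⁻¹' s)ᶜ)) n
  have hS : ∀ n, S (n + 1) = S n ∪ (A n ∩ (T ⁻¹' S n)ᶜ ∩ (T.symm ⁻¹' S n)ᶜ) := fun n => rfl
  have hmono : Monotone S := monotone_nat_of_le_succ fun n => by
    rw [hS]
    exact Set.subset_union_left
  have hmeas : ∀ n, MeasurableSet (S n) := by
    intro n
    induction n with
    | zero => exact MeasurableSet.empty
    | succ n ih =>
      rw [hS]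
      exact ih.union (((hA n).inter (T.measurable ih).compl).inter (T.symm.measurable ih).compl)
  have hind : ∀ n, ∀ x ∈ S n, T x ∉ S n := by
    intro n
    induction n with
    | zero => intro x hx; exact absurd hx (Set.notMem_empty x)
    | succ n ih =>
      intro x hx hTx
      rw [hS] at hx hTx
      rcases hx with hx | ⟨⟨hx, hx1⟩, hx2⟩ <;> rcases hTx with hy | ⟨⟨hy, hy1⟩, hy2⟩
      · exact ih x hx hy
      · exact hy2 (by simpa using hx)
      · exact hx1 hy
      · exact hAT n x hx hy
  refine ⟨⋃ n, S n, MeasurableSet.iUnion hmeas, ?_, ?_⟩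
  · intro x hx hTx
    obtain ⟨m, hm⟩ := Set.mem_iUnion.1 hx
    obtain ⟨n, hn⟩ := Set.mem_iUnion.1 hTx
    exact hind (max m n) x (hmono (le_max_left m n) hm) (hmono (le_max_right m n) hn)
  -- A point of `A n` not chosen by stage n + 1 was blocked by one of its two neighbours.
  · intro n x hx
    rcases Classical.em (T x ∈ S n) with h1 | h1
    · exact Or.inr (Or.inl (Set.mem_iUnion.2 ⟨n, h1⟩))
    rcases Classical.em (T.symm x ∈ S n) with h2 | h2
    · exact Or.inr (Or.inr (Set.mem_iUnion.2 ⟨n, h2⟩))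
    exact Or.inl (Set.mem_iUnion.2 ⟨n + 1, by rw [hS]; exact Or.inr ⟨⟨hx, h1⟩, h2⟩⟩)

/-- Every measurable automorphism has a measurable three-colouring of its non-fixed points. -/
theorem exists_measurable_coloring {X : Type*} [MeasurableSpace X] [StandardBorelSpace X]
    (T : X ≃ᵐ X) :
    ∃ c : X → Fin 3, Measurable c ∧ ∀ x, T x ≠ x → c (T x) ≠ c x := by
  classical
  obtain ⟨f, hf, hinj⟩ := MeasurableSpace.measurable_injection_nat_bool_of_countablySeparated X
  obtain ⟨e, he⟩ := exists_surjective_nat (ℕ × Bool)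
  -- For a non-fixed point, some bit of the separating code changes under T; the sets are indexed by
  -- the position and the value of that bit.
  obtain ⟨B, hB, hBT, hcov⟩ := exists_maximal_independent T
    (fun k => {x | f x (e k).1 = (e k).2 ∧ f (T x) (e k).1 ≠ (e k).2})
    (fun k => by
      have h : Measurable fun x => f x (e k).1 := (measurable_pi_apply _).comp hf
      exact (h (MeasurableSet.singleton (e k).2)).inter
        ((h.comp T.measurable) (MeasurableSet.singleton (e k).2)).compl)
    (fun k x hx hTx => hx.2 hTx.1)
  -- Colour 2 at a non-fixed x means that x and its preimage are outside B, so T x is in B and has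
  -- colour 0.
  refine ⟨fun x => if x ∈ B then 0 else if T.symm x ∈ B then 1 else 2, ?_, ?_⟩
  · exact Measurable.ite hB measurable_const
      (Measurable.ite (T.symm.measurable hB) measurable_const measurable_const)
  · intro x hx
    have hx' : x ∈ B ∨ T x ∈ B ∨ T.symm x ∈ B := by
      obtain ⟨n, hn⟩ := Function.ne_iff.1 (hinj.ne hx)
      obtain ⟨k, hk⟩ := he (n, f x n)
      exact hcov k x ⟨by simp [hk], by simpa [hk] using hn⟩
    by_cases h1 : x ∈ B
    · have h2 : T x ∉ B := hBT x h1
      simp [h1, h2]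
    · by_cases h2 : T x ∈ B
      · by_cases h3 : T.symm x ∈ B <;> simp [h1, h2, h3]
      · have h3 : T.symm x ∈ B := by tauto
        simp [h1, h2, h3]

/-- The transformation of `γ` as a measurable automorphism. -/
def MPAction.toMeasurableEquiv {Γ : Type*} [Group Γ] {X : Type*} [MeasurableSpace X]
    {μ : Measure X} (a : MPAction Γ μ) (γ : Γ) : X ≃ᵐ X where
  toEquiv := a.act γ
  measurable_toFun := (a.measurePreserving γ).measurable
  measurable_invFun := by
    have h := (a.measurePreserving γ⁻¹).measurable
    rwa [map_inv] at h

/-- A finite measurable colouring which simultaneously distinguishes `x` from `γ x`, for all `γ`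
in a finite set with `γ x ≠ x`. -/
theorem MPAction.exists_coloring {Γ : Type*} [Group Γ] {X : Type*} [MeasurableSpace X]
    [StandardBorelSpace X] {μ : Measure X} (a : MPAction Γ μ) (F : Finset Γ) :
    ∃ c : X → (F → Fin 3), Measurable c ∧
      ∀ (γ : F) x, a.act γ x ≠ x → c (a.act γ x) γ ≠ c x γ := by
  choose c hc hne using fun γ : F => exists_measurable_coloring (a.toMeasurableEquiv γ)
  exact ⟨fun x γ => c γ x, measurable_pi_iff.2 hc, fun γ x => hne γ x⟩

/-! ### Free parts under weak containment -/

/-- The set of points moved by all elements of `F`. -/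
def MPAction.freePart {Γ : Type*} [Group Γ] {X : Type*} [MeasurableSpace X] {μ : Measure X}
    (a : MPAction Γ μ) (F : Finset Γ) : Set X :=
  {x | ∀ γ ∈ F, a.act γ x ≠ x}

theorem MPAction.measurableSet_freePart {Γ : Type*} [Group Γ] {X : Type*} [MeasurableSpace X]
    [StandardBorelSpace X] {μ : Measure X} (a : MPAction Γ μ) (F : Finset Γ) :
    MeasurableSet (a.freePart F) := by
  have h : a.freePart F = ⋂ γ ∈ F, {x | a.act γ x = x}ᶜ := by
    ext x
    simp [freePart]
  rw [h]
  exact Finset.measurableSet_biInter _ fun γ _ =>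
    (measurableSet_eq_fun (a.measurePreserving γ).measurable measurable_id).compl

/-- The free part is partitioned into measurable pieces, finitely many, that are disjoint from
their translates by `F`; the index `0` stands for the complement of the free part. -/
theorem MPAction.exists_partition {Γ : Type*} [Group Γ] {X : Type*} [MeasurableSpace X]
    [StandardBorelSpace X] {μ : Measure X} (a : MPAction Γ μ) (F : Finset Γ) :
    ∃ (k : ℕ) (A : Fin (k + 1) → Set X), IsBorelPartition A ∧ A 0 = (a.freePart F)ᶜ ∧
      ∀ i, i ≠ 0 → ∀ γ ∈ F, (a.act γ '' A i) ∩ A i = ∅ := by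
  classical
  obtain ⟨c, hc, hne⟩ := a.exists_coloring F
  let e := Fintype.equivFin (F → Fin 3)
  have hD := a.measurableSet_freePart F
  let d : X → Fin (Fintype.card (F → Fin 3) + 1) :=
    fun x => if x ∈ a.freePart F then (e (c x)).succ else 0
  have hd : Measurable d :=
    Measurable.ite hD ((measurable_of_countable fun y => (e y).succ).comp hc) measurable_const
  refine ⟨_, fun i => d ⁻¹' {i}, ⟨fun i => hd (MeasurableSet.singleton i), ?_, ?_⟩, ?_, ?_⟩
  · intro i j hij
    exact Disjoint.preimage d (by simpa using hij)
  · ext x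
    simp
  · ext x
    by_cases hx : x ∈ a.freePart F <;> simp [d, hx]
  · rintro i hi γ hγ
    rw [Set.eq_empty_iff_forall_notMem]
    rintro _ ⟨⟨x, hx, rfl⟩, hy⟩
    have key : ∀ z, d z = i → z ∈ a.freePart F ∧ (e (c z)).succ = i := by
      intro z hz
      by_cases h : z ∈ a.freePart F
      · exact ⟨h, by simpa [d, h] using hz⟩
      · exact absurd (by simpa [d, h] using hz.symm) hi
    obtain ⟨h1, h2⟩ := key x hx
    obtain ⟨-, h3⟩ := key _ hy
    refine hne ⟨γ, hγ⟩ x (h1 γ hγ) ?_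
    rw [e.injective (Fin.succ_injective _ (h3.trans h2.symm))]

/-- Weak containment does not decrease the measures of the free parts. -/
theorem WeaklyContained.measureReal_freePart_le {Γ : Type*} [Group Γ] {X : Type*}
    [MeasurableSpace X] [StandardBorelSpace X] {μ : Measure X} [IsProbabilityMeasure μ]
    {Y : Type*} [MeasurableSpace Y] [StandardBorelSpace Y] {ν : Measure Y} [IsProbabilityMeasure ν]
    {a : MPAction Γ μ} {b : MPAction Γ ν} (h : WeaklyContained a b) (F : Finset Γ) :
    μ.real (a.freePart F) ≤ ν.real (b.freePart F) := by
  classical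
  obtain ⟨k, A, hA, hA0, hAF⟩ := a.exists_partition F
  -- One ε pays for `B 0`, and one for each pair of a piece and an element of F.
  have main : ∀ ε > 0, μ.real (a.freePart F) ≤ ν.real (b.freePart F) + (1 + k * F.card) * ε := by
    intro ε hε
    -- Adding 1 to F gives control of the measure of `B 0` itself.
    obtain ⟨B, hB, hBA⟩ := h (k + 1) A hA (insert 1 F) ε hε
    have h0 : ν.real (B 0) < μ.real (A 0) + ε := by
      have := hBA 1 (Finset.mem_insert_self _ _) 0 0
      simp only [map_one, Equiv.Perm.coe_one, Set.image_id, Set.inter_self] at this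
      linarith [(abs_lt.1 this).1]
    have hsmall : ∀ i : Fin k, ∀ γ ∈ F, ν.real ((b.act γ '' B i.succ) ∩ B i.succ) ≤ ε := by
      intro i γ hγ
      have := hBA γ (Finset.mem_insert_of_mem hγ) i.succ i.succ
      rw [hAF _ (Fin.succ_ne_zero i) γ hγ, measureReal_empty] at this
      linarith [(abs_lt.1 this).1]
    have hsub : (b.freePart F)ᶜ ⊆
        B 0 ∪ ⋃ i ∈ (Finset.univ : Finset (Fin k)), ⋃ γ ∈ F,
          (b.act γ '' B i.succ) ∩ B i.succ := by
      intro y hy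
      obtain ⟨γ, hγ, hfix⟩ : ∃ γ ∈ F, b.act γ y = y := by simpa [MPAction.freePart] using hy
      obtain ⟨i, hi⟩ := Set.mem_iUnion.1 (hB.iUnion_eq ▸ Set.mem_univ y)
      rcases Fin.eq_zero_or_eq_succ i with rfl | ⟨j, rfl⟩
      · exact Or.inl hi
      · exact Or.inr (Set.mem_biUnion (Finset.mem_univ j)
          (Set.mem_biUnion hγ ⟨⟨y, hi, hfix⟩, hi⟩))
    have hbound : ν.real (b.freePart F)ᶜ ≤ ν.real (B 0) + k * F.card * ε := by
      refine (measureReal_mono hsub).trans ((measureReal_union_le _ _).trans ?_)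
      gcongr
      refine (measureReal_biUnion_finset_le _ _).trans ?_
      refine (Finset.sum_le_sum fun i _ => (measureReal_biUnion_finset_le F _).trans
        (Finset.sum_le_sum fun γ hγ => hsmall i γ hγ)).trans ?_
      simp [mul_assoc]
    have e1 := probReal_compl_eq_one_sub (μ := ν) (b.measurableSet_freePart F)
    have e2 := probReal_compl_eq_one_sub (μ := μ) (a.measurableSet_freePart F)
    rw [hA0] at h0
    linarith
  refine le_of_forall_pos_le_add fun δ hδ => ?_
  have hC : (0 : ℝ) < 1 + k * F.card := by positivity
  have := main (δ / (1 + k * F.card)) (div_pos hδ hC)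
  rwa [mul_div_cancel₀ _ hC.ne'] at this

/-! ### Subgroups avoiding a finite set -/

theorem mem_iff_subIndicator {Γ : Type*} [Group Γ] (γ : Γ) (H : Subgroup Γ) :
    γ ∈ H ↔ subIndicator H γ = true := by
  simp [subIndicator]

/-- The subgroup axioms are closed conditions on finitely many coordinates each. Compactness of
Sub(Γ), and metrizability for countable Γ, follow from this. -/
theorem isClosedEmbedding_subIndicator (Γ : Type*) [Group Γ] :
    IsClosedEmbedding (subIndicator : Subgroup Γ → Γ → Bool) := by
  refine ⟨⟨⟨rfl⟩, fun H H' h => ?_⟩, ?_⟩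
  · ext γ
    rw [mem_iff_subIndicator, mem_iff_subIndicator, h]
  · have hc : ∀ γ : Γ, IsClopen {f : Γ → Bool | f γ = true} := fun γ =>
      (isClopen_discrete {true}).preimage (continuous_apply γ)
    have h : Set.range (subIndicator : Subgroup Γ → Γ → Bool) =
        {f | f 1 = true} ∩ (⋂ γ : Γ, ⋂ δ : Γ,
          ({f | f γ = true} ∩ {f | f δ = true})ᶜ ∪ {f | f (γ * δ) = true}) ∩
        ⋂ γ : Γ, {f | f γ = true}ᶜ ∪ {f | f γ⁻¹ = true} := by
      ext f
      constructor
      · rintro ⟨H, rfl⟩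
        simp only [Set.mem_inter_iff, Set.mem_iInter, Set.mem_union, Set.mem_compl_iff,
          Set.mem_ofPred_eq, ← mem_iff_subIndicator]
        refine ⟨⟨H.one_mem, fun γ δ => ?_⟩, fun γ => ?_⟩
        · by_cases h : γ ∈ H ∧ δ ∈ H
          · exact Or.inr (H.mul_mem h.1 h.2)
          · exact Or.inl h
        · by_cases h : γ ∈ H
          · exact Or.inr (H.inv_mem h)
          · exact Or.inl h
      · rintro ⟨⟨h1, h2⟩, h3⟩
        simp only [Set.mem_iInter, Set.mem_union, Set.mem_compl_iff, Set.mem_inter_iff,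
          Set.mem_ofPred_eq] at h1 h2 h3
        refine ⟨⟨⟨⟨{γ | f γ = true}, ?_⟩, h1⟩, ?_⟩, ?_⟩
        · intro γ δ hγ hδ
          exact (h2 γ δ).resolve_left (not_not.2 ⟨hγ, hδ⟩)
        · intro γ hγ
          exact (h3 γ).resolve_left (not_not.2 hγ)
        · funext γ
          rw [Bool.eq_iff_iff, ← mem_iff_subIndicator]
          rfl
    rw [h]
    exact ((hc 1).isClosed.inter (isClosed_iInter fun γ => isClosed_iInter fun δ =>
      ((hc γ).inter (hc δ)).compl.isClosed.union (hc _).isClosed)).inter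
      (isClosed_iInter fun γ => (hc γ).compl.isClosed.union (hc _).isClosed)

instance compactSpace_subgroup (Γ : Type*) [Group Γ] : CompactSpace (Subgroup Γ) :=
  (isClosedEmbedding_subIndicator Γ).compactSpace

instance metrizableSpace_subgroup (Γ : Type*) [Group Γ] [Countable Γ] :
    MetrizableSpace (Subgroup Γ) :=
  (isClosedEmbedding_subIndicator Γ).isEmbedding.metrizableSpace

/-- The set of subgroups of `Γ` that do not meet `F`. -/
def avoidSet {Γ : Type*} [Group Γ] (F : Finset Γ) : Set (Subgroup Γ) :=
  {H | ∀ γ ∈ F, γ ∉ H}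

theorem isClopen_avoidSet {Γ : Type*} [Group Γ] (F : Finset Γ) : IsClopen (avoidSet F) := by
  have h : avoidSet F = ⋂ γ ∈ F, {H : Subgroup Γ | subIndicator H γ = true}ᶜ := by
    ext H
    simp [avoidSet, mem_iff_subIndicator]
  rw [h]
  exact isClopen_biInter_finset fun γ _ => ((isClopen_discrete {true}).preimage
    ((continuous_apply γ).comp (isClosedEmbedding_subIndicator Γ).continuous)).compl

/-- A probability measure on `Sub(Γ)` is determined by its values on the sets `avoidSet F`. -/
theorem probabilityMeasure_ext_avoidSet {Γ : Type*} [Group Γ] [Countable Γ]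
    {θ θ' : ProbabilityMeasure (Subgroup Γ)} (h : ∀ F, θ (avoidSet F) = θ' (avoidSet F)) :
    θ = θ' := by
  classical
  suffices h' : (θ : Measure (Subgroup Γ)) = θ' from Subtype.ext h'
  refine ext_of_generate_finite (Set.range (avoidSet (Γ := Γ))) ?_ ?_ ?_ (by simp)
  · refine le_antisymm ?_ ?_
    -- The Borel structure is generated by the events γ ∈ H, the complements of `avoidSet {γ}`.
    · have hid : @Measurable _ _ (MeasurableSpace.generateFrom (Set.range (avoidSet (Γ := Γ))))
          (subMeasurableSpace Γ) (id : Subgroup Γ → Subgroup Γ) := by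
        refine (@measurable_sub_iff Γ _ _ _
          (MeasurableSpace.generateFrom (Set.range (avoidSet (Γ := Γ)))) id).2 fun γ => ?_
        rw [← MeasurableSet.compl_iff]
        refine MeasurableSpace.measurableSet_generateFrom ⟨{γ}, ?_⟩
        ext H
        simp [avoidSet]
      intro s hs
      exact hid hs
    · refine MeasurableSpace.generateFrom_le ?_
      rintro _ ⟨F, rfl⟩
      exact (isClopen_avoidSet F).isOpen.measurableSet
  · rintro _ ⟨F, rfl⟩ _ ⟨F', rfl⟩ -
    refine ⟨F ∪ F', ?_⟩
    ext H
    simp [avoidSet, or_imp, forall_and]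
  · rintro _ ⟨F, rfl⟩
    have := congrArg ENNReal.ofNNReal (h F)
    simpa using this

/-- Portmanteau: a clopen set has empty boundary. -/
theorem continuous_apply_of_isClopen {Ω : Type*} [TopologicalSpace Ω] [MeasurableSpace Ω]
    [OpensMeasurableSpace Ω] [HasOuterApproxClosed Ω] {U : Set Ω} (hU : IsClopen U) :
    Continuous fun θ : ProbabilityMeasure Ω => θ U :=
  continuous_iff_continuousAt.2 fun _ =>
    ProbabilityMeasure.tendsto_measure_of_isClopen_of_tendsto Filter.tendsto_id hU

/-- The weak-* topology on the probability measures on `Sub(Γ)` is the topology of convergence on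
the sets `avoidSet F`. -/
theorem isEmbedding_avoidSet (Γ : Type*) [Group Γ] [Countable Γ] :
    IsEmbedding fun (θ : ProbabilityMeasure (Subgroup Γ)) (F : Finset Γ) => θ (avoidSet F) :=
  -- A continuous injection from a compact space to a Hausdorff space is an embedding.
  (Continuous.isClosedEmbedding
    (continuous_pi fun F => continuous_apply_of_isClopen (isClopen_avoidSet F))
    fun _ _ h => probabilityMeasure_ext_avoidSet fun F => congrFun h F).isEmbedding

theorem MPAction.type_avoidSet {Γ : Type*} [Group Γ] [Countable Γ] {X : Type*}
    [MeasurableSpace X] [StandardBorelSpace X] {μ : Measure X} [IsProbabilityMeasure μ]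
    (a : MPAction Γ μ) (F : Finset Γ) :
    (((a.type : ProbabilityMeasure (Subgroup Γ)) (avoidSet F) : NNReal) : ℝ) =
      μ.real (a.freePart F) := by
  change (μ.map a.stab).real (avoidSet F) = _
  rw [map_measureReal_apply a.measurable_stab (isClopen_avoidSet F).isOpen.measurableSet]
  rfl

theorem WeaklyEquivalent.type_eq {Γ : Type*} [Group Γ] [Countable Γ] {X : Type*}
    [MeasurableSpace X] [StandardBorelSpace X] {μ : Measure X} [IsProbabilityMeasure μ]
    {Y : Type*} [MeasurableSpace Y] [StandardBorelSpace Y] {ν : Measure Y} [IsProbabilityMeasure ν]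
    {a : MPAction Γ μ} {b : MPAction Γ ν} (h : WeaklyEquivalent a b) : a.type = b.type := by
  refine Subtype.ext (probabilityMeasure_ext_avoidSet fun F => NNReal.coe_injective ?_)
  rw [a.type_avoidSet, b.type_avoidSet]
  exact le_antisymm (h.1.measureReal_freePart_le F) (h.2.measureReal_freePart_le F)

/-! ### Continuity of the type -/

/-- The Cantor space maps continuously onto every nonempty finite discrete space. -/
theorem exists_continuous_surjective {K : Type*} [TopologicalSpace K]
    (hK : Nonempty (K ≃ₜ (ℕ → Bool))) (D : Type*) [Finite D] [Nonempty D] [TopologicalSpace D] :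
    ∃ r : K → D, Continuous r ∧ Function.Surjective r := by
  obtain ⟨e⟩ := hK
  obtain ⟨n, ⟨j⟩⟩ : ∃ n : ℕ, Nonempty (D ↪ (Fin n → Bool)) := by
    obtain ⟨n, ⟨i⟩⟩ := Finite.exists_equiv_fin D
    exact ⟨n, ⟨⟨fun d k => decide (i d = k), fun d d' h => by
      have := congrFun h (i d')
      simpa using this⟩⟩⟩
  -- Read the first n bits and decode them; the decoding is continuous because its domain is finite
  -- and discrete.
  refine ⟨fun z => Function.invFun j fun k => e z k, ?_, ?_⟩
  · exact (continuous_of_discreteTopology (f := Function.invFun j)).comp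
      (continuous_pi fun k : Fin n => (continuous_apply (k : ℕ)).comp e.continuous)
  · intro d
    refine ⟨e.symm fun m => if h : m < n then j d ⟨m, h⟩ else false, ?_⟩
    have : (fun k : Fin n => e (e.symm fun m => if h : m < n then j d ⟨m, h⟩ else false) k) =
        j d := by
      funext k
      simp
    exact (congrArg (Function.invFun j) this).trans <| Function.leftInverse_invFun j.injective d

/-- The set of `z ∈ K^Γ` whose colouring by `r` distinguishes `1` from `γ⁻¹` in the coordinate `γ`,
for all `γ ∈ F`. -/
def separatedSet {Γ : Type*} [Group Γ] {K : Type*} (F : Finset Γ) (r : K → (F → Fin 3)) :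
    Set (Γ → K) :=
  {z | ∀ γ : F, r (z (γ : Γ)⁻¹) γ ≠ r (z 1) γ}

theorem isClopen_separatedSet {Γ : Type*} [Group Γ] {K : Type*} [TopologicalSpace K]
    (F : Finset Γ) {r : K → (F → Fin 3)} (hr : Continuous r) : IsClopen (separatedSet F r) := by
  have h : separatedSet F r =
      ⋂ γ : F, {z : Γ → K | r (z (γ : Γ)⁻¹) γ = r (z 1) γ}ᶜ := by
    ext z
    simp [separatedSet]
  rw [h]
  refine isClopen_iInter_of_finite fun γ => IsClopen.compl ?_
  have hc : ∀ δ : Γ, Continuous fun z : Γ → K => r (z δ) γ := fun δ =>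
    (continuous_apply γ).comp (hr.comp (continuous_apply δ))
  exact (isClopen_discrete {p : Fin 3 × Fin 3 | p.1 = p.2}).preimage
    ((hc (γ : Γ)⁻¹).prodMk (hc 1))

/-- The measure of the free part is the maximum over `closure E(a, K)` of a continuous function
that does not depend on the action. -/
theorem exists_continuous_max_eq_freePart {Γ : Type*} [Group Γ] [Countable Γ] (K : Type*)
    [TopologicalSpace K] [CompactSpace K] [PolishSpace K] [Nonempty K]
    [MeasurableSpace K] [BorelSpace K] (hK : Nonempty (K ≃ₜ (ℕ → Bool))) (F : Finset Γ)
    {X : Type*} [MeasurableSpace X] [StandardBorelSpace X] (μ : Measure X)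
    [IsProbabilityMeasure μ] :
    ∃ f : ShiftInvMeasure Γ K → ℝ, Continuous f ∧ ∀ a : MPAction Γ μ,
      (∀ lam ∈ a.closedFactorSet K, f lam ≤ μ.real (a.freePart F)) ∧
      ∃ lam ∈ a.closedFactorSet K, f lam = μ.real (a.freePart F) := by
  obtain ⟨r, hr, hsurj⟩ := exists_continuous_surjective hK (F → Fin 3)
  have hU := isClopen_separatedSet F hr
  have hf : Continuous fun lam : ShiftInvMeasure Γ K =>
      (((lam : ProbabilityMeasure (Γ → K)) (separatedSet F r) : NNReal) : ℝ) :=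
    NNReal.continuous_coe.comp ((continuous_apply_of_isClopen hU).comp continuous_subtype_val)
  have hval : ∀ (a : MPAction Γ μ) (φ : X → K) (hφ : Measurable φ),
      (((a.factorMeasure φ hφ : ProbabilityMeasure (Γ → K)) (separatedSet F r) : NNReal) : ℝ) =
        μ.real {x | ∀ γ : F, r (φ (a.act γ x)) γ ≠ r (φ x) γ} := by
    intro a φ hφ
    change (μ.map (a.orbitMap φ)).real (separatedSet F r) = _
    rw [map_measureReal_apply (a.measurable_orbitMap hφ) hU.isOpen.measurableSet]
    simp [MPAction.orbitMap, separatedSet]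
  refine ⟨_, hf, fun a => ⟨fun lam hlam => ?_, ?_⟩⟩
  -- The bound is a closed condition, so E(a, K) suffices; there, a point fixed by some γ ∈ F has
  -- the same colour as its image.
  · refine closure_minimal (s := a.factorSet K) ?_ (isClosed_le hf continuous_const) hlam
    rintro _ ⟨φ, hφ, rfl⟩
    refine (hval a φ hφ).trans_le (measureReal_mono fun x hx γ hγ hfix => hx ⟨γ, hγ⟩ ?_)
    simp [hfix]
  -- Lifting the separating colouring c through r attains the maximum already in E(a, K).
  · obtain ⟨c, hc, hne⟩ := a.exists_coloring F
    obtain ⟨s, hs⟩ := hsurj.hasRightInverse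
    have hφ : Measurable (s ∘ c) := (measurable_of_countable s).comp hc
    refine ⟨a.factorMeasure _ hφ, subset_closure ⟨_, hφ, rfl⟩, (hval a _ hφ).trans ?_⟩
    congr 1
    ext x
    simp only [Function.comp_apply, hs _, Set.mem_ofPred_eq, MPAction.freePart]
    refine ⟨fun h γ hγ hfix => h ⟨γ, hγ⟩ (by simp [hfix]), fun h γ => hne γ x (h γ γ.2)⟩

/-- The measure of the free part depends continuously on `closure E(a, K)`. -/
theorem continuous_freePart {Γ : Type*} [Group Γ] [Countable Γ] (K : Type*)
    [TopologicalSpace K] [CompactSpace K] [PolishSpace K] [Nonempty K]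
    [MeasurableSpace K] [BorelSpace K] (hK : Nonempty (K ≃ₜ (ℕ → Bool))) (F : Finset Γ)
    {X : Type*} [MeasurableSpace X] [StandardBorelSpace X] (μ : Measure X)
    [IsProbabilityMeasure μ] :
    Continuous[TopologicalSpace.induced (MPAction.closedFactorSet (Γ := Γ) (μ := μ) K)
      NonemptyCompacts.topology, inferInstance] fun a : MPAction Γ μ => μ.real (a.freePart F) := by
  let _ : TopologicalSpace (MPAction Γ μ) := TopologicalSpace.induced
    (MPAction.closedFactorSet (Γ := Γ) (μ := μ) K) NonemptyCompacts.topology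
  obtain ⟨f, hf, hmax⟩ := exists_continuous_max_eq_freePart K hK F μ
  rw [continuous_iff_lower_upperSemicontinuous, lowerSemicontinuous_iff_isOpen_preimage,
    upperSemicontinuous_iff_isOpen_preimage]
  -- The maximum exceeds y iff the compact set meets {f > y}, and is below y iff the set lies in {f
  -- < y}: the two kinds of Vietoris-open sets.
  refine ⟨fun y => ⟨_, NonemptyCompacts.isOpen_inter_nonempty_of_isOpen
    (hf.isOpen_preimage _ (isOpen_Ioi (a := y))), ?_⟩, fun y => ⟨_,
    NonemptyCompacts.isOpen_subsets_of_isOpen (hf.isOpen_preimage _ (isOpen_Iio (a := y))), ?_⟩⟩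
  · ext a
    obtain ⟨hle, lam, hlam, heq⟩ := hmax a
    constructor
    · rintro ⟨lam', h1, h2⟩
      exact lt_of_lt_of_le h2 (hle lam' h1)
    · intro h
      exact ⟨lam, hlam, by simpa [heq] using h⟩
  · ext a
    obtain ⟨hle, lam, hlam, heq⟩ := hmax a
    constructor
    · intro h
      have := h hlam
      simpa [heq] using this
    · intro h lam' h1
      exact lt_of_le_of_lt (hle lam' h1) h

theorem continuous_type {Γ : Type*} [Group Γ] [Countable Γ] (K : Type*)
    [TopologicalSpace K] [CompactSpace K] [PolishSpace K] [Nonempty K]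
    [MeasurableSpace K] [BorelSpace K] (hK : Nonempty (K ≃ₜ (ℕ → Bool)))
    {X : Type*} [MeasurableSpace X] [StandardBorelSpace X] (μ : Measure X)
    [IsProbabilityMeasure μ] :
    Continuous[TopologicalSpace.induced (MPAction.closedFactorSet (Γ := Γ) (μ := μ) K)
      NonemptyCompacts.topology, inferInstance] (MPAction.type (Γ := Γ) (μ := μ)) := by
  let _ : TopologicalSpace (MPAction Γ μ) := TopologicalSpace.induced
    (MPAction.closedFactorSet (Γ := Γ) (μ := μ) K) NonemptyCompacts.topology
  refine continuous_induced_rng.2 ((isEmbedding_avoidSet Γ).continuous_iff.2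
    (continuous_pi fun F => NNReal.isEmbedding_coe.continuous_iff.2 ?_))
  refine (continuous_freePart K hK F μ).congr fun a => ?_
  exact (a.type_avoidSet F).symm

end WeakEq

open WeakEq in
theorem theorem5p3 {Γ : Type*} [Group Γ] [Countable Γ] :
    (∀ {X : Type*} [MeasurableSpace X] [StandardBorelSpace X]
        (μ : Measure X) [IsProbabilityMeasure μ]
        {Y : Type*} [MeasurableSpace Y] [StandardBorelSpace Y]
        (ν : Measure Y) [IsProbabilityMeasure ν]
        (a : MPAction Γ μ) (b : MPAction Γ ν),
        WeaklyEquivalent a b → a.type = b.type) ∧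
    (∀ {X : Type*} [MeasurableSpace X] [StandardBorelSpace X]
        (μ : Measure X) [IsProbabilityMeasure μ]
        (K : Type*) [TopologicalSpace K] [CompactSpace K] [PolishSpace K] [Nonempty K]
        [MeasurableSpace K] [BorelSpace K], Nonempty (K ≃ₜ (ℕ → Bool)) →
        ∃ T : WeakClass Γ μ → IRS Γ,
          (∀ a : MPAction Γ μ, T a.weakClass = a.type) ∧
          Continuous[weakClassTopology μ K, inferInstance] T) := by
  refine ⟨fun μ _ _ _ _ ν _ a b h => h.type_eq, fun μ _ K _ _ _ _ _ _ hK => ?_⟩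
  refine ⟨Quotient.lift MPAction.type fun a b h => WeaklyEquivalent.type_eq h, fun a => rfl, ?_⟩
  -- Continuity out of a coinduced topology can be tested on the actions themselves.
  exact continuous_coinduced_dom.2 (continuous_type K hK μ)
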